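/- Let $\Gamma$ be a finite directed graph with vertex set $V$ and edge set $E$ (multiple edges and loops allowed); write $s_e,t_e$ for the starting and terminal vertex of $e$. For spinors $z,w\in\mathbb C^2$ put $\langle z|w\rangle=\bar z^0w^0+\bar z^1w^1$, $|z]=(-\bar z^1,\bar z^0)^T$, so that $[z|=(-z^1,z^0)$ and $[z|w\rangle=z^0w^1-z^1w^0$. Attach to every edge $e$ two spinors $z_e,z_{e^{-1}}\in\mathbb C^2$. For spins $j_e\in\{0,\tfrac12,1,\dots\}$ let $J_v=\sum_{e:s_e=v}j_e+\sum_{e:t_e=v}j_e$ and $$A_\Gamma(j_e,z_e)=\int_{SU(2)^V}\prod_{v\in V}dg_v\prod_{e\in E}\frac{[z_e|g_{s_e}g_{t_e}^{-1}|z_{e^{-1}}\rangle^{2j_e}}{(2j_e)!},\qquad \mathcal A_\Gamma(z_e)=\sum_{(j_e)_{e\in E}}\Big(\prod_{v\in V}(J_v+1)!\Big)A_\Gamma(j_e,z_e),$$ where $dg$ is the normalized Haar measure and $(J+1)!=\Gamma(J+2)$. Let $d\mu(\alpha)=\pi^{-2}e^{-\langle\alpha|\alpha\rangle}d^4\alpha$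 on $\mathbb C^2$, and let $X=X(z_e)$ be the $2|V|\times2|V|$ matrix with $2\times2$ blocks $$X_{ij}=\sum_{e:\,s_e=i,\,t_e=j}|z_e\rangle[z_{e^{-1}}|-\sum_{e:\,t_e=i,\,s_e=j}|z_{e^{-1}}\rangle[z_e|\qquad(i,j\in V).$$ (1) For all $(z_e,z_{e^{-1}})_{e\in E}$ in some neighbourhood of $0$ in $(\mathbb C^2\times\mathbb C^2)^E$, the Hermitian part of $1+X$ is positive definite, the series $\mathcal A_\Gamma(z_e)$ converges absolutely, and $$\mathcal A_\Gamma(z_e)=\int_{(\mathbb C^2)^V}\prod_{i\in V}d\mu(\alpha_i)\,\exp\Big(-\sum_{i,j\in V}\langle\alpha_i|X_{ij}|\alpha_j\rangle\Big)=\frac1{\det(1+X(z_e))}.$$ (2) Whenever the Hermitian part of $1+X$ is positive definite, the Gaussian integral converges absolutely, $\det(1+X)\neq0$, and the second equality holds. (3) Whenever the series $\mathcal A_\Gamma(z_e)$ converges absolutely, $\det(1+X)\ne0$ and $\mathcal A_\Gamma(z_e)=1/\det(1+X)$. (4) The set $D=\{\det(1+X)\neq0\}$ is open and connected, and $1/\det(1+X)$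 is holomorphic on it. If $U$ is any connected open neighbourhood of $0$ and $F$ is holomorphic on $U$ and agrees with $\mathcal A_\Gamma$ near $0$, then $U\subseteq D$ and $F=1/\det(1+X)$ on $U$. So $1/\det(1+X)$ is the analytic continuation of $\mathcal A_\Gamma$, and $D$ is its maximal domain. -/

import Mathlib

open MeasureTheory Filter Topology
open scoped ComplexOrder

noncomputable section

namespace SpinNetwork

/-! ### Spinors -/

/-- A spinor `|z⟩` is a vector of `ℂ²`. -/
abbrev Spinor : Type := Fin 2 → ℂ

/-- The contragredient spinor `|z] = (- conj z¹, conj z⁰)`. -/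
def contra (z : Spinor) : Spinor := ![-star (z 1), star (z 0)]

/-- The hermitian product `⟨z|w⟩`, antilinear in `z`. -/
def braket (z w : Spinor) : ℂ := star z ⬝ᵥ w

/-- The holomorphic product `[z|w⟩ = z⁰ w¹ - z¹ w⁰`, the hermitian product of `|z]` with `|w⟩`. -/
def sqBraket (z w : Spinor) : ℂ := braket (contra z) w

/-- The outer product `|z⟩[w|`, a `2 × 2` matrix. -/
def ketSqBra (z w : Spinor) : Matrix (Fin 2) (Fin 2) ℂ := Matrix.vecMulVec z (star (contra w))

/-- Explicit formula for the holomorphic product. -/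
theorem sqBraket_eq (z w : Spinor) : sqBraket z w = z 0 * w 1 - z 1 * w 0 := by
  simp [sqBraket, braket, contra, dotProduct, Fin.sum_univ_two]
  ring

/-- `|z⟩[w|` maps `|u⟩` to `[w|u⟩ |z⟩`. -/
theorem ketSqBra_mulVec (z w u : Spinor) :
    (ketSqBra z w).mulVec u = sqBraket w u • z := by
  ext i
  simp [ketSqBra, sqBraket, braket, Matrix.vecMulVec_mulVec, mul_comm]

/-! ### The group `SU(2)` and its normalized Haar measure -/

/-- The group `SU(2)`. -/
abbrev SU2 : Type := Matrix.specialUnitaryGroup (Fin 2) ℂ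

instance : IsTopologicalGroup SU2 where
  continuous_inv := by
    refine Continuous.subtype_mk (f := fun g : SU2 => star (g : Matrix (Fin 2) (Fin 2) ℂ)) ?_ _
    exact continuous_subtype_val.star

instance : CompactSpace SU2 := by
  have hc : IsClosed {A : Matrix (Fin 2) (Fin 2) ℂ | A ∈ Matrix.specialUnitaryGroup (Fin 2) ℂ} := by
    have : {A : Matrix (Fin 2) (Fin 2) ℂ | A ∈ Matrix.specialUnitaryGroup (Fin 2) ℂ}
        = {A | A * star A = 1} ∩ {A | A.det = 1} := by
      ext A
      simp [Matrix.mem_specialUnitaryGroup_iff, Matrix.mem_unitaryGroup_iff]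
    rw [this]
    exact (isClosed_eq (continuous_id.mul continuous_id.star) continuous_const).inter
      (isClosed_eq continuous_id.matrix_det continuous_const)
  have hK : IsCompact (Set.univ.pi fun _ : Fin 2 => Set.univ.pi fun _ : Fin 2 =>
      Metric.closedBall (0 : ℂ) 1) :=
    isCompact_univ_pi fun _ => isCompact_univ_pi fun _ => isCompact_closedBall 0 1
  refine isCompact_iff_compactSpace.mp (hK.of_isClosed_subset hc ?_)
  intro A hA i _ j _
  simpa using entry_norm_bound_of_unitary (Matrix.mem_specialUnitaryGroup_iff.mp hA).1 i j

instance : MeasurableSpace SU2 := borel SU2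

instance : BorelSpace SU2 := ⟨rfl⟩

/-- The Haar measure `dg` on `SU(2)`, normalized to total mass one. -/
def haarSU2 : Measure SU2 := Measure.haarMeasure ⊤

/-! ### Coherent amplitudes of a finite directed graph

A finite directed graph with vertex set `V` and edge set `E` is given by the maps `src` and `tgt`
sending an edge to its starting and terminal vertex; multiple edges and loops are allowed. -/

section Graph

/-- The spinor labels of a graph: `z.1 e` is `z_e` and `z.2 e` is `z_{e⁻¹}`. -/
abbrev Labels (E : Type*) : Type _ := (E → Spinor) × (E → Spinor)

variable {V E : Type*} [Fintype V] [DecidableEq V] [Fintype E]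

/-- The sum `J_v` of the spins at the vertex `v`, where `d e = 2 j_e`. -/
def vertexSpin (src tgt : E → V) (d : E → ℕ) (v : V) : ℝ :=
  (∑ e with src e = v, (d e : ℝ) / 2) + (∑ e with tgt e = v, (d e : ℝ) / 2)

/-- The coherent amplitude `A_Γ(j_e, z_e)`, where `d e = 2 j_e`. -/
def amplitude (src tgt : E → V) (z : Labels E) (d : E → ℕ) : ℂ :=
  ∫ g : V → SU2, (∏ e,
    (sqBraket (z.1 e) ((g (src e) * (g (tgt e))⁻¹ : SU2).1.mulVec (z.2 e))) ^ d e
      / ((d e).factorial : ℂ))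
    ∂(Measure.pi fun _ => haarSU2)

/-- The term `∏_v (J_v + 1)! A_Γ(j_e, z_e)` of the generating functional, where `d e = 2 j_e` and
`(J + 1)! = Γ(J + 2)` (`J` may be a half-integer). -/
def genTerm (src tgt : E → V) (z : Labels E) (d : E → ℕ) : ℂ :=
  (∏ v, (Real.Gamma (vertexSpin src tgt d v + 2) : ℂ)) * amplitude src tgt z d

/-- The coherent generating functional `𝒜_Γ(z_e)`, the sum over all spins
`j_e ∈ {0, 1/2, 1, …}`. -/
def genFunctional (src tgt : E → V) (z : Labels E) : ℂ :=
  ∑' d : E → ℕ, genTerm src tgt z d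

/-- The block `X_ij` of the matrix `X(z_e)`. -/
def blockX (src tgt : E → V) (z : Labels E) (i j : V) : Matrix (Fin 2) (Fin 2) ℂ :=
  (∑ e with src e = i ∧ tgt e = j, ketSqBra (z.1 e) (z.2 e))
    - (∑ e with tgt e = i ∧ src e = j, ketSqBra (z.2 e) (z.1 e))

/-- The `2|V| × 2|V|` matrix `X(z_e)` made of the blocks `X_ij`. -/
def matrixX (src tgt : E → V) (z : Labels E) : Matrix (V × Fin 2) (V × Fin 2) ℂ :=
  Matrix.of fun p q => blockX src tgt z p.1 q.1 p.2 q.2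

/-- `det (1 + X(z_e))`. -/
def detX (src tgt : E → V) (z : Labels E) : ℂ := (1 + matrixX src tgt z).det

/-- The hermitian part of `1 + X(z_e)` is positive definite. -/
def HermPartPosDef (src tgt : E → V) (z : Labels E) : Prop :=
  ((1 / 2 : ℂ) • ((1 + matrixX src tgt z) + (1 + matrixX src tgt z).conjTranspose)).PosDef

/-- The Gaussian measure `dμ(α) = e^{-⟨α|α⟩} d⁴α / π²` on `ℂ²`. -/
def gaussianMeasure : Measure Spinor :=
  (volume : Measure Spinor).withDensity
    fun α => ENNReal.ofReal (Real.exp (-(braket α α).re) / Real.pi ^ 2)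

/-- The integrand `exp (- ∑_{i,j} ⟨α_i| X_ij |α_j⟩)`. -/
def gaussianIntegrand (src tgt : E → V) (z : Labels E) (α : V → Spinor) : ℂ :=
  Complex.exp (-(∑ i, ∑ j, braket (α i) ((blockX src tgt z i j).mulVec (α j))))

/-- The Gaussian integral over one spinor per vertex. -/
def gaussianIntegral (src tgt : E → V) (z : Labels E) : ℂ :=
  ∫ α : V → Spinor, gaussianIntegrand src tgt z α ∂(Measure.pi fun _ => gaussianMeasure)

end Graph

end SpinNetwork

end

/-! The Haar integrals are Gaussian moments in disguise. Every spinor is its radius times an `SU(2)`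
rotation of the reference spinor `(1,0)`, and `dμ` is rotation invariant. A Gaussian moment of a
monomial homogeneous of degree `2J_v` at each vertex therefore splits into an `SU(2)` average and
radial moments, and the radial moments are exactly the factors `Γ(J_v + 2)`. Inserting `1 = |e⟩⟨e| +
|e][e|` between `g_s` and `g_t⁻¹` makes the amplitude such an average (`sqBraket_mul_inv_mulVec`,
`genTerm_eq_integral`). Summing over spins rebuilds the exponential of the edge terms, whose
exponent is `-⟨α|X|α⟩`; for small labels half of the Gaussian weight dominates the expansion
(`ExponentBound.hasSum_genTerm`).

The Gaussian integral is computed by writing `1 + X = Tᴴ D T` with `D` diagonal of real part one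
(`integral_matrix_gaussian`).

Beyond small labels the identity is kept in the product form `𝒜 · det(1+X) = 1`, which also excludes
zeros of the determinant. At a point of convergence, scaling the labels `z_e` alone by `t` gives a
power series on the closed unit disc; the identity theorem and continuity carry the product to `t =
1`. The same product on `U` gives maximality. The complement of the zeros is connected because each
complex line through `0` meets the zero set in finitely many points. -/

noncomputable section

namespace SpinNetwork

/-! ### Gaussian integrals of complex matrices. -/

section MatrixGaussian

open Matrix

/-- A matrix with positive definite Hermitian part is congruent to a diagonal matrix whose entries
have real part one. -/
theorem exists_congr_diagonal_of_posDef {n : Type*} [Fintype n] [DecidableEq n]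
    (M : Matrix n n ℂ) (hM : ((1 / 2 : ℂ) • (M + Mᴴ)).PosDef) :
    ∃ (T : Matrix n n ℂ) (d : n → ℝ), IsUnit T ∧
      M = Tᴴ * diagonal (fun k => 1 + Complex.I * d k) * T := by
  -- Write `M = P + iQ` with `P = Sᴴ S` positive definite and `Q` Hermitian. Congruence by `S⁻¹`
  -- turns `P` into `1` and keeps `Q` Hermitian, so a unitary `U` then diagonalizes it; hence `T =
  -- Uᴴ S`.
  obtain ⟨S, hS, hP⟩ : ∃ S : Matrix n n ℂ, IsUnit S ∧ (1 / 2 : ℂ) • (M + Mᴴ) = Sᴴ * S := by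
    open scoped MatrixOrder in
    exact CStarAlgebra.isStrictlyPositive_iff_eq_star_mul_self.mp hM.isStrictlyPositive
  set Q : Matrix n n ℂ := (-Complex.I / 2) • (M - Mᴴ) with hQ
  have hQH : Q.IsHermitian := by
    rw [IsHermitian, hQ, conjTranspose_smul, conjTranspose_sub, conjTranspose_conjTranspose,
      ← neg_sub M, smul_neg, ← neg_smul]
    congr 1
    simp [neg_div]
  have hH : ((S⁻¹)ᴴ * Q * S⁻¹).IsHermitian := isHermitian_conjTranspose_mul_mul _ hQH
  set U : Matrix n n ℂ := (hH.eigenvectorUnitary : Matrix n n ℂ) with hU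
  have hUU : U * star U = 1 := Unitary.coe_mul_star_self _
  have hUU' : star U * U = 1 := Unitary.coe_star_mul_self _
  set D : Matrix n n ℂ := diagonal (fun k => (hH.eigenvalues k : ℂ)) with hD
  have hspec : (S⁻¹)ᴴ * Q * S⁻¹ = U * D * star U := hH.spectral_theorem
  have hSi : S⁻¹ * S = 1 := nonsing_inv_mul _ ((isUnit_iff_isUnit_det S).mp hS)
  have hSi' : Sᴴ * (S⁻¹)ᴴ = 1 := by rw [← conjTranspose_mul, hSi, conjTranspose_one]
  refine ⟨star U * S, hH.eigenvalues, (IsUnit.of_mul_eq_one _ hUU').mul hS, ?_⟩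
  have hdiag : diagonal (fun k => 1 + Complex.I * (hH.eigenvalues k : ℂ)) = 1 + Complex.I • D := by
    rw [hD, ← diagonal_one, ← diagonal_smul, diagonal_add]
    rfl
  have hQ' : Q = Sᴴ * (U * D * star U) * S := by
    rw [← hspec]
    calc Q = (Sᴴ * (S⁻¹)ᴴ) * Q * (S⁻¹ * S) := by rw [hSi, hSi']; simp
      _ = _ := by simp only [mul_assoc]
  have hMPQ : M = (1 / 2 : ℂ) • (M + Mᴴ) + Complex.I • Q := by
    rw [hQ, smul_smul]
    have : Complex.I * (-Complex.I / 2) = 1 / 2 := by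
      rw [mul_div_assoc', mul_neg, Complex.I_mul_I, neg_neg]
    rw [this, ← smul_add, add_add_sub_cancel, ← two_smul ℂ M, smul_smul]
    norm_num
  rw [hdiag, conjTranspose_mul, ← star_eq_conjTranspose (star U), star_star, mul_add, add_mul,
    mul_one]
  conv_lhs => rw [hMPQ, hP, hQ']
  congr 1
  · calc Sᴴ * S = Sᴴ * (U * star U) * S := by rw [hUU, mul_one]
      _ = _ := by simp only [mul_assoc]
  · simp only [mul_assoc, mul_smul_comm, smul_mul_assoc]

theorem star_dotProduct_congr_diagonal {n : Type*} [Fintype n] [DecidableEq n]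
    (T : Matrix n n ℂ) (c : n → ℂ) (a : n → ℂ) :
    star a ⬝ᵥ ((Tᴴ * diagonal c * T) *ᵥ a) = ∑ k, c k * (‖(T *ᵥ a) k‖ : ℂ) ^ 2 := by
  rw [mul_assoc, ← mulVec_mulVec, dotProduct_mulVec, ← star_mulVec, ← mulVec_mulVec, dotProduct]
  refine Finset.sum_congr rfl fun k _ => ?_
  rw [mulVec_diagonal, Pi.star_apply, ← Complex.conj_mul']
  simp only [RCLike.star_def]
  ring

theorem integrable_cexp_neg_mul_norm_sq {c : ℂ} (hc : 0 < c.re) :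
    Integrable (fun z : ℂ => Complex.exp (-(c * (‖z‖ : ℂ) ^ 2))) := by
  have := GaussianFourier.integrable_cexp_neg_mul_sq_norm_add (V := ℂ) hc 0 0
  simpa using this

theorem integral_cexp_neg_mul_norm_sq {c : ℂ} (hc : 0 < c.re) :
    ∫ z : ℂ, Complex.exp (-(c * (‖z‖ : ℂ) ^ 2)) = Real.pi / c := by
  have := GaussianFourier.integral_cexp_neg_mul_sq_norm (V := ℂ) hc
  simpa using this

variable {ι κ : Type*} [Fintype ι] [Fintype κ]

theorem cexp_neg_sum_mul_norm_sq (c : ι → κ → ℂ) (α : ι → κ → ℂ) :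
    Complex.exp (-(∑ k : ι × κ, c k.1 k.2 * (‖α k.1 k.2‖ : ℂ) ^ 2)) =
      ∏ i, ∏ k, Complex.exp (-(c i k * (‖α i k‖ : ℂ) ^ 2)) := by
  rw [Fintype.sum_prod_type, ← Finset.sum_neg_distrib, Complex.exp_sum]
  refine Finset.prod_congr rfl fun i _ => ?_
  rw [← Finset.sum_neg_distrib, Complex.exp_sum]

theorem integrable_diagonal_gaussian {c : ι → κ → ℂ} (hc : ∀ i k, 0 < (c i k).re) :
    Integrable (fun α : ι → κ → ℂ =>
      Complex.exp (-(∑ k : ι × κ, c k.1 k.2 * (‖α k.1 k.2‖ : ℂ) ^ 2))) := by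
  simp only [cexp_neg_sum_mul_norm_sq]
  exact Integrable.fintype_prod
    (f := fun i (β : κ → ℂ) => ∏ k, Complex.exp (-(c i k * (‖β k‖ : ℂ) ^ 2)))
    fun i => Integrable.fintype_prod
      (f := fun k (z : ℂ) => Complex.exp (-(c i k * (‖z‖ : ℂ) ^ 2)))
      fun k => integrable_cexp_neg_mul_norm_sq (hc i k)

theorem integral_diagonal_gaussian {c : ι → κ → ℂ} (hc : ∀ i k, 0 < (c i k).re) :
    ∫ α : ι → κ → ℂ, Complex.exp (-(∑ k : ι × κ, c k.1 k.2 * (‖α k.1 k.2‖ : ℂ) ^ 2)) =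
      ∏ k : ι × κ, (Real.pi / c k.1 k.2) := by
  simp only [cexp_neg_sum_mul_norm_sq]
  rw [Fintype.prod_prod_type]
  rw [integral_fintype_prod_volume_eq_prod
    (f := fun i (β : κ → ℂ) => ∏ k, Complex.exp (-(c i k * (‖β k‖ : ℂ) ^ 2)))]
  refine Finset.prod_congr rfl fun i _ => ?_
  rw [integral_fintype_prod_volume_eq_prod
      (f := fun k (z : ℂ) => Complex.exp (-(c i k * (‖z‖ : ℂ) ^ 2)))]
  exact Finset.prod_congr rfl fun k _ => integral_cexp_neg_mul_norm_sq (hc i k)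

/-- A complex matrix acting on curried vectors. -/
def curriedLin [DecidableEq ι] [DecidableEq κ] (T : Matrix (ι × κ) (ι × κ) ℂ) :
    (ι → κ → ℂ) →ₗ[ℂ] (ι → κ → ℂ) :=
  (LinearEquiv.curry ℂ ℂ ι κ).toLinearMap ∘ₗ Matrix.toLin' T ∘ₗ
    (LinearEquiv.curry ℂ ℂ ι κ).symm.toLinearMap

/-- The real Jacobian of a complex-linear map is the squared modulus of its complex determinant.
This is the factor that the congruence by `T` puts into the determinant of `Tᴴ D T`. -/
theorem det_curriedLin [DecidableEq ι] [DecidableEq κ] (T : Matrix (ι × κ) (ι × κ) ℂ) :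
    LinearMap.det ((curriedLin T).restrictScalars ℝ) = ‖T.det‖ ^ 2 := by
  rw [LinearMap.det_restrictScalars, Algebra.norm_complex_apply, curriedLin]
  rw [← LinearMap.det_toLin' T, ← Complex.normSq_eq_norm_sq]
  congr 1
  exact LinearMap.det_conj _ _

/-- The Gaussian integral of a matrix with positive definite Hermitian part. -/
theorem integral_matrix_gaussian [DecidableEq ι] [DecidableEq κ] (M : Matrix (ι × κ) (ι × κ) ℂ)
    (hM : ((1 / 2 : ℂ) • (M + Mᴴ)).PosDef) :
    Integrable (fun α : ι → κ → ℂ =>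
      Complex.exp (-(star (Function.uncurry α) ⬝ᵥ M *ᵥ Function.uncurry α))) ∧ M.det ≠ 0 ∧
    ∫ α : ι → κ → ℂ, Complex.exp (-(star (Function.uncurry α) ⬝ᵥ M *ᵥ Function.uncurry α)) =
      Real.pi ^ Fintype.card (ι × κ) / M.det := by
  obtain ⟨T, d, hT, rfl⟩ := exists_congr_diagonal_of_posDef M hM
  have hTdet : T.det ≠ 0 := ((isUnit_iff_isUnit_det T).mp hT).ne_zero
  set c : ι × κ → ℂ := fun k => 1 + Complex.I * d k with hc
  have hcre : ∀ i k, 0 < (c (i, k)).re := by simp [hc]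
  have hc0 : ∀ k, c k ≠ 0 := fun k h => by
    have := hcre k.1 k.2
    rw [Prod.mk.eta, h] at this
    simp at this
  set L : (ι → κ → ℂ) →ₗ[ℝ] (ι → κ → ℂ) := (curriedLin T).restrictScalars ℝ with hL
  have hLdet : LinearMap.det L = ‖T.det‖ ^ 2 := det_curriedLin T
  have hLdet0 : LinearMap.det L ≠ 0 := by rw [hLdet]; positivity
  set G : (ι → κ → ℂ) → ℂ := fun α =>
    Complex.exp (-(∑ k : ι × κ, c k * (‖α k.1 k.2‖ : ℂ) ^ 2)) with hG
  have hform : ∀ α : ι → κ → ℂ, Complex.exp (-(star (Function.uncurry α) ⬝ᵥ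
      (Tᴴ * diagonal c * T) *ᵥ Function.uncurry α)) = G (L α) := fun α => by
    rw [star_dotProduct_congr_diagonal]
    rfl
  have hmeas : Measurable L := L.continuous_of_finiteDimensional.measurable
  have : (volume : Measure (κ → ℂ)).IsAddHaarMeasure := Measure.pi.isAddHaarMeasure _
  have : (volume : Measure (ι → κ → ℂ)).IsAddHaarMeasure := Measure.pi.isAddHaarMeasure _
  have hmap := Measure.map_linearMap_addHaar_eq_smul_addHaar
    (volume : Measure (ι → κ → ℂ)) hLdet0
  have hGc : Continuous G := by fun_prop
  have hGi : Integrable G := integrable_diagonal_gaussian (c := fun i k => c (i, k)) hcre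
  have hdet : (Tᴴ * diagonal c * T).det = ‖T.det‖ ^ 2 * ∏ k, c k := by
    rw [det_mul, det_mul, det_conjTranspose, det_diagonal, ← Complex.conj_mul']
    simp only [RCLike.star_def]
    ring
  have hTn : (‖T.det‖ : ℂ) ≠ 0 := by simpa using hTdet
  have hprod : ∏ k, c k ≠ 0 := Finset.prod_ne_zero_iff.mpr fun k _ => hc0 k
  simp only [hform]
  refine ⟨?_, ?_, ?_⟩
  · have : Integrable G (Measure.map L volume) := by
      rw [hmap]
      exact hGi.smul_measure ENNReal.ofReal_ne_top
    exact this.comp_measurable hmeas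
  · rw [hdet]
    exact mul_ne_zero (pow_ne_zero 2 hTn) hprod
  · rw [← integral_map hmeas.aemeasurable hGc.aestronglyMeasurable, hmap, integral_smul_measure,
      hG, integral_diagonal_gaussian (c := fun i k => c (i, k)) hcre, hdet, hLdet,
      ENNReal.toReal_ofReal (abs_nonneg _), abs_of_nonneg (by positivity)]
    simp only [Prod.mk.eta, Finset.prod_div_distrib, Finset.prod_const, Finset.card_univ]
    rw [Complex.real_smul]
    push_cast
    field_simp

end MatrixGaussian

/-- Both measures agree on boxes, where the integral of a product density factors. Integrability of
`ρ` makes every factor finite, as the characterization by boxes needs. -/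
theorem _root_.MeasureTheory.Measure.pi_withDensity_ofReal {ι X : Type*} [Fintype ι]
    [MeasurableSpace X] (μ : Measure X) [SigmaFinite μ] (ρ : X → ℝ) (hρ : Integrable ρ μ)
    (hρ0 : ∀ x, 0 ≤ ρ x) :
    Measure.pi (fun _ : ι => μ.withDensity fun x => ENNReal.ofReal (ρ x)) =
      (Measure.pi fun _ : ι => μ).withDensity fun x => ENNReal.ofReal (∏ i, ρ (x i)) := by
  have : IsFiniteMeasure (μ.withDensity fun x => ENNReal.ofReal (ρ x)) :=
    isFiniteMeasure_withDensity_ofReal hρ.2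
  refine Measure.pi_eq fun s hs => ?_
  rw [withDensity_apply _ (MeasurableSet.univ_pi hs), Measure.restrict_pi_pi,
    ← ofReal_integral_eq_lintegral_ofReal
      (Integrable.fintype_prod (f := fun _ => ρ) fun i => hρ.mono_measure Measure.restrict_le_self)
      (ae_of_all _ fun x => Finset.prod_nonneg fun i _ => hρ0 _),
    integral_fintype_prod_eq_prod (f := fun _ => ρ),
    ENNReal.ofReal_prod_of_nonneg fun i _ => integral_nonneg hρ0]
  refine Finset.prod_congr rfl fun i _ => ?_
  rw [withDensity_apply _ (hs i), ofReal_integral_eq_lintegral_ofReal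
    (hρ.mono_measure Measure.restrict_le_self) (ae_of_all _ hρ0)]

/-! ### The Gaussian measure on spinors -/

theorem braket_self (α : Spinor) : braket α α = ((∑ k, ‖α k‖ ^ 2 : ℝ) : ℂ) := by
  simp [braket, dotProduct, Complex.conj_mul']

theorem braket_self_re (α : Spinor) : (braket α α).re = ∑ k, ‖α k‖ ^ 2 := by
  rw [braket_self, Complex.ofReal_re]

theorem braket_self_re_nonneg (α : Spinor) : 0 ≤ (braket α α).re := by
  rw [braket_self_re]
  positivity

theorem continuous_braket_self_re : Continuous fun α : Spinor => (braket α α).re := by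
  simp only [braket_self_re]
  fun_prop

/-- The density of the Gaussian measure on `ℂ²`. -/
def gaussianDensity (α : Spinor) : ℝ := Real.exp (-(braket α α).re) / Real.pi ^ 2

theorem gaussianDensity_nonneg (α : Spinor) : 0 ≤ gaussianDensity α := by
  unfold gaussianDensity
  positivity

theorem continuous_gaussianDensity : Continuous gaussianDensity := by
  have := continuous_braket_self_re
  unfold gaussianDensity
  fun_prop

theorem integrable_exp_neg_mul_braket {b : ℝ} (hb : 0 < b) :
    Integrable (fun α : Spinor => Real.exp (-(b * (braket α α).re))) := by
  have h := (Integrable.fintype_prod (f := fun (_ : Fin 2) (z : ℂ) =>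
    Complex.exp (-((b : ℂ) * (‖z‖ : ℂ) ^ 2))) (μ := fun _ => volume)
      fun k => integrable_cexp_neg_mul_norm_sq (by simpa using hb)).norm
  refine h.congr (ae_of_all _ fun α => ?_)
  simp only [norm_prod, Complex.norm_exp]
  rw [← Real.exp_sum, braket_self_re, Finset.mul_sum, ← Finset.sum_neg_distrib]
  refine congrArg _ (Finset.sum_congr rfl fun k _ => ?_)
  rw [← Complex.ofReal_pow, ← Complex.ofReal_mul, Complex.neg_re, Complex.ofReal_re]

theorem integrable_gaussianDensity : Integrable gaussianDensity := by
  have := (integrable_exp_neg_mul_braket one_pos).div_const (Real.pi ^ 2)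
  simp only [one_mul] at this
  exact this

theorem gaussianMeasure_eq :
    gaussianMeasure = volume.withDensity fun α => ENNReal.ofReal (gaussianDensity α) := rfl

instance : IsFiniteMeasure gaussianMeasure :=
  isFiniteMeasure_withDensity_ofReal integrable_gaussianDensity.2

section

variable {V E : Type*} [Fintype V]

theorem pi_gaussianMeasure :
    Measure.pi (fun _ : V => gaussianMeasure) =
      volume.withDensity fun α => ENNReal.ofReal (∏ i, gaussianDensity (α i)) :=
  Measure.pi_withDensity_ofReal _ _ integrable_gaussianDensity gaussianDensity_nonneg

theorem measurable_prod_gaussianDensity :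
    Measurable fun α : V → Spinor => ENNReal.ofReal (∏ i, gaussianDensity (α i)) := by
  have := continuous_gaussianDensity
  have : Continuous fun α : V → Spinor => ∏ i, gaussianDensity (α i) := by fun_prop
  exact ENNReal.measurable_ofReal.comp this.measurable

theorem integrable_pi_gaussianMeasure (f : (V → Spinor) → ℂ) :
    Integrable f (Measure.pi fun _ : V => gaussianMeasure) ↔
      Integrable fun α => ((∏ i, gaussianDensity (α i) : ℝ) : ℂ) * f α := by
  rw [pi_gaussianMeasure, integrable_withDensity_iff_integrable_smul'
    measurable_prod_gaussianDensity (ae_of_all _ fun α => ENNReal.ofReal_lt_top)]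
  refine iff_of_eq (congrArg (fun h => Integrable h volume) (funext fun α => ?_))
  rw [ENNReal.toReal_ofReal (Finset.prod_nonneg fun i _ => gaussianDensity_nonneg _),
    Complex.real_smul]

theorem integral_pi_gaussianMeasure (f : (V → Spinor) → ℂ) :
    ∫ α, f α ∂(Measure.pi fun _ : V => gaussianMeasure) =
      ∫ α, ((∏ i, gaussianDensity (α i) : ℝ) : ℂ) * f α := by
  rw [pi_gaussianMeasure, integral_withDensity_eq_integral_toReal_smul
    measurable_prod_gaussianDensity (ae_of_all _ fun α => ENNReal.ofReal_lt_top)]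
  refine integral_congr_ae (ae_of_all _ fun α => ?_)
  simp only
  rw [ENNReal.toReal_ofReal (Finset.prod_nonneg fun i _ => gaussianDensity_nonneg _),
    Complex.real_smul]

theorem sum_braket_blockX [DecidableEq V] [Fintype E] (src tgt : E → V)
    (z : Labels E) (α : V → Spinor) :
    ∑ i, ∑ j, braket (α i) ((blockX src tgt z i j).mulVec (α j)) =
      star (Function.uncurry α) ⬝ᵥ (matrixX src tgt z).mulVec (Function.uncurry α) := by
  simp only [braket, dotProduct, Matrix.mulVec, Fintype.sum_prod_type, Pi.star_apply,
    Function.uncurry_apply_pair, matrixX, Matrix.of_apply, Finset.mul_sum]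
  exact Finset.sum_congr rfl fun i _ => Finset.sum_comm

theorem sum_braket_self (α : V → Spinor) :
    star (Function.uncurry α) ⬝ᵥ Function.uncurry α = ((∑ i, (braket (α i) (α i)).re : ℝ) : ℂ) := by
  simp only [dotProduct, Fintype.sum_prod_type, Pi.star_apply, Function.uncurry_apply_pair,
    braket_self_re, RCLike.star_def, Complex.conj_mul']
  push_cast
  rfl

theorem prod_gaussianDensity (α : V → Spinor) :
    ∏ i, gaussianDensity (α i) =
      Real.exp (-∑ i, (braket (α i) (α i)).re) * (Real.pi ^ (2 * Fintype.card V))⁻¹ := by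
  simp only [gaussianDensity]
  rw [Finset.prod_div_distrib, ← Real.exp_sum, Finset.sum_neg_distrib, Finset.prod_const,
    Finset.card_univ, pow_mul, div_eq_mul_inv]

/-- The weight `e^{-⟨α|α⟩}` supplies the `1` in `1 + X`. -/
theorem prod_gaussianDensity_mul_integrand [DecidableEq V] [Fintype E] (src tgt : E → V)
    (z : Labels E) (α : V → Spinor) :
    ((∏ i, gaussianDensity (α i) : ℝ) : ℂ) * gaussianIntegrand src tgt z α =
      Complex.exp (-(star (Function.uncurry α) ⬝ᵥ
        (1 + matrixX src tgt z).mulVec (Function.uncurry α))) *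
        ((Real.pi : ℂ) ^ (2 * Fintype.card V))⁻¹ := by
  rw [prod_gaussianDensity, gaussianIntegrand, sum_braket_blockX, Matrix.add_mulVec,
    Matrix.one_mulVec, dotProduct_add, sum_braket_self, neg_add, Complex.exp_add]
  push_cast
  ring

theorem gaussianIntegral_of_hermPartPosDef [DecidableEq V] [Fintype E] (src tgt : E → V)
    (z : Labels E) (h : HermPartPosDef src tgt z) :
    Integrable (gaussianIntegrand src tgt z) (Measure.pi fun _ => gaussianMeasure) ∧
      detX src tgt z ≠ 0 ∧ gaussianIntegral src tgt z = 1 / detX src tgt z := by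
  obtain ⟨hi, hd, hint⟩ := integral_matrix_gaussian _ h
  refine ⟨?_, hd, ?_⟩
  · rw [integrable_pi_gaussianMeasure]
    simp only [prod_gaussianDensity_mul_integrand]
    exact hi.mul_const _
  · rw [gaussianIntegral, integral_pi_gaussianMeasure]
    simp only [prod_gaussianDensity_mul_integrand]
    rw [integral_mul_const]
    erw [hint]
    rw [Fintype.card_prod, Fintype.card_fin, mul_comm 2, detX]
    have : (Real.pi : ℂ) ≠ 0 := by exact_mod_cast Real.pi_ne_zero
    field_simp

end

/-! ### Radial moments -/

/-- The Euclidean norm of a spinor. -/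
def radius (α : Spinor) : ℝ := Real.sqrt (braket α α).re

theorem radius_nonneg (α : Spinor) : 0 ≤ radius α := Real.sqrt_nonneg _

theorem radius_sq (α : Spinor) : radius α ^ 2 = (braket α α).re :=
  Real.sq_sqrt (braket_self_re_nonneg α)

theorem norm_toLp_eq_radius (α : Spinor) : ‖WithLp.toLp 2 α‖ = radius α := by
  rw [EuclideanSpace.norm_eq, radius, braket_self_re]

/-- Polar coordinates in real dimension four. The constant stays unspecified because the case `n =
0` determines it later. -/
theorem exists_integral_radius_pow_mul_exp :
    ∃ C : ℝ, ∀ n : ℕ, ∫ α : Spinor, radius α ^ n * Real.exp (-(braket α α).re) =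
      C * Real.Gamma (n / 2 + 2) := by
  have : (volume : Measure Spinor).IsAddHaarMeasure := Measure.pi.isAddHaarMeasure _
  -- `Spinor` carries the sup norm, so the volume is transported to the Euclidean space before the
  -- radial formula is used.
  let L := (PiLp.continuousLinearEquiv 2 ℝ (fun _ : Fin 2 => ℂ)).symm
  let μ : Measure (EuclideanSpace ℂ (Fin 2)) := Measure.map L (volume : Measure Spinor)
  have : μ.IsAddHaarMeasure := L.isAddHaarMeasure_map _
  have hdim : Module.finrank ℝ (EuclideanSpace ℂ (Fin 2)) = 4 := by
    rw [finrank_real_of_complex, finrank_euclideanSpace, Fintype.card_fin]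
  refine ⟨4 * μ.real (Metric.ball 0 1) * (1 / 2), fun n => ?_⟩
  have h1 := integral_fun_norm_addHaar μ fun y => y ^ n * Real.exp (-y ^ 2)
  have h2 : ∫ x, ‖x‖ ^ n * Real.exp (-‖x‖ ^ 2) ∂μ =
      ∫ α : Spinor, radius α ^ n * Real.exp (-(braket α α).re) := by
    rw [integral_map L.continuous.aemeasurable (by fun_prop)]
    refine integral_congr_ae (ae_of_all _ fun α => ?_)
    change ‖WithLp.toLp 2 α‖ ^ n * Real.exp (-‖WithLp.toLp 2 α‖ ^ 2) = _
    rw [norm_toLp_eq_radius, radius_sq]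
  have h3 : ∫ y in Set.Ioi (0 : ℝ), y ^ (4 - 1) • (y ^ n * Real.exp (-y ^ 2)) =
      1 / 2 * Real.Gamma (n / 2 + 2) := by
    -- The exponent `n + 3` includes the Jacobian `y ^ 3` of polar coordinates.
    have h := integral_rpow_mul_exp_neg_rpow (p := 2) (q := n + 3) two_pos
      (by linarith [n.cast_nonneg (α := ℝ)])
    rw [show ((n : ℝ) + 3 + 1) / 2 = n / 2 + 2 by ring] at h
    rw [← h]
    refine setIntegral_congr_fun measurableSet_Ioi fun y hy => ?_
    have : y ^ ((n : ℝ) + 3) = y ^ (n + 3) := by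
      rw [← Real.rpow_natCast]
      norm_cast
    simp only [smul_eq_mul, this, Real.rpow_two]
    ring
  rw [← h2, h1, hdim, h3]
  simp only [nsmul_eq_mul, smul_eq_mul]
  push_cast
  ring

theorem integral_exp_neg_braket :
    ∫ α : Spinor, Real.exp (-(braket α α).re) = Real.pi ^ 2 := by
  have h : ∀ α : Spinor, Real.exp (-(braket α α).re) = ∏ k, Real.exp (-(1 : ℝ) * ‖α k‖ ^ 2) :=
    fun α => by
      rw [← Real.exp_sum, ← Finset.mul_sum, braket_self_re]
      ring_nf
  simp only [h]
  rw [integral_fintype_prod_volume_eq_prod (f := fun _ (z : ℂ) => Real.exp (-(1 : ℝ) * ‖z‖ ^ 2))]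
  rw [GaussianFourier.integral_rexp_neg_mul_sq_norm (V := ℂ) one_pos]
  simp

theorem integral_radius_pow_mul_exp (n : ℕ) :
    ∫ α : Spinor, radius α ^ n * Real.exp (-(braket α α).re) =
      Real.pi ^ 2 * Real.Gamma (n / 2 + 2) := by
  obtain ⟨C, hC⟩ := exists_integral_radius_pow_mul_exp
  have h0 := hC 0
  simp only [pow_zero, one_mul, integral_exp_neg_braket, Nat.cast_zero, zero_div, zero_add,
    Real.Gamma_two, mul_one] at h0
  rw [hC, h0]

theorem integrable_radius_pow_mul_gaussianDensity (n : ℕ) :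
    Integrable fun α : Spinor => gaussianDensity α * radius α ^ n := by
  have h : Integrable fun α : Spinor => radius α ^ n * Real.exp (-(braket α α).re) := by
    -- A non-integrable function would have integral `0`, whereas the computed value is positive.
    refine .of_integral_ne_zero ?_
    rw [integral_radius_pow_mul_exp]
    have : 0 < Real.Gamma (n / 2 + 2) := Real.Gamma_pos_of_pos (by positivity)
    positivity
  refine (h.div_const (Real.pi ^ 2)).congr (ae_of_all _ fun α => ?_)
  simp only [gaussianDensity]
  ring

theorem integrable_gaussianMeasure_iff (f : Spinor → ℝ) :
    Integrable f gaussianMeasure ↔ Integrable fun α => gaussianDensity α * f α := by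
  rw [gaussianMeasure_eq, integrable_withDensity_iff_integrable_smul'
    (by exact continuous_gaussianDensity.measurable.ennreal_ofReal)
    (ae_of_all _ fun α => ENNReal.ofReal_lt_top)]
  simp only [ENNReal.toReal_ofReal (gaussianDensity_nonneg _), smul_eq_mul]

theorem integral_gaussianMeasure (f : Spinor → ℝ) :
    ∫ α, f α ∂gaussianMeasure = ∫ α, gaussianDensity α * f α := by
  rw [gaussianMeasure_eq, integral_withDensity_eq_integral_toReal_smul
    (by exact continuous_gaussianDensity.measurable.ennreal_ofReal)
    (ae_of_all _ fun α => ENNReal.ofReal_lt_top)]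
  simp only [ENNReal.toReal_ofReal (gaussianDensity_nonneg _), smul_eq_mul]

theorem integrable_radius_pow (n : ℕ) : Integrable (fun α => radius α ^ n) gaussianMeasure :=
  (integrable_gaussianMeasure_iff _).mpr (integrable_radius_pow_mul_gaussianDensity n)

theorem integral_radius_pow (n : ℕ) :
    ∫ α, radius α ^ n ∂gaussianMeasure = Real.Gamma (n / 2 + 2) := by
  rw [integral_gaussianMeasure]
  have h : ∀ α : Spinor, gaussianDensity α * radius α ^ n =
      (Real.pi ^ 2)⁻¹ * (radius α ^ n * Real.exp (-(braket α α).re)) := fun α => by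
    simp only [gaussianDensity]
    ring
  simp only [h]
  rw [integral_const_mul, integral_radius_pow_mul_exp]
  have := Real.pi_ne_zero
  field_simp

/-! ### Haar measure on `SU(2)` and its action on spinors -/

instance : SecondCountableTopology SU2 := by
  have : SecondCountableTopology (Matrix (Fin 2) (Fin 2) ℂ) :=
    inferInstanceAs (SecondCountableTopology (Fin 2 → Fin 2 → ℂ))
  exact TopologicalSpace.Subtype.secondCountableTopology _

instance : haarSU2.IsHaarMeasure := by
  unfold haarSU2
  infer_instance

instance : IsProbabilityMeasure haarSU2 :=
  ⟨by
    simpa [haarSU2] using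
      Measure.haarMeasure_self (K₀ := (⊤ : TopologicalSpace.PositiveCompacts SU2))⟩

/-- A right translate of Haar measure is again a Haar probability measure, and such a measure is
unique. -/
theorem map_mul_right_haarSU2 (k : SU2) : haarSU2.map (· * k) = haarSU2 := by
  have hm : Measurable fun g : SU2 => g * k := measurable_mul_const k
  have : IsProbabilityMeasure (haarSU2.map (· * k)) :=
    Measure.isProbabilityMeasure_map hm.aemeasurable
  have : (haarSU2.map (· * k)).IsHaarMeasure := Measure.isHaarMeasure_map_mul_right _ k
  exact Measure.isHaarMeasure_eq_of_isProbabilityMeasure _ _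

theorem continuous_coe_SU2 : Continuous fun g : SU2 => (g : Matrix (Fin 2) (Fin 2) ℂ) :=
  continuous_subtype_val

theorem SU2.adjugate_eq_star (g : SU2) : (g.1).adjugate = star g.1 := by
  obtain ⟨hu, hd⟩ := Matrix.mem_specialUnitaryGroup_iff.mp g.2
  have h1 : star g.1 * g.1 = 1 := Matrix.mem_unitaryGroup_iff'.mp hu
  have h2 : g.1 * (g.1).adjugate = 1 := by rw [Matrix.mul_adjugate, hd, one_smul]
  exact (left_inv_eq_right_inv h1 h2).symm

theorem SU2.apply_zero_one (g : SU2) : g.1 0 1 = -star (g.1 1 0) := by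
  have h := congrFun (congrFun (SU2.adjugate_eq_star g) 0) 1
  rw [Matrix.adjugate_fin_two] at h
  simp only [Matrix.of_apply, Matrix.cons_val_zero, Matrix.cons_val_one, Matrix.star_apply] at h
  rw [← h, neg_neg]

theorem SU2.apply_one_one (g : SU2) : g.1 1 1 = star (g.1 0 0) := by
  have h := congrFun (congrFun (SU2.adjugate_eq_star g) 0) 0
  rw [Matrix.adjugate_fin_two] at h
  simpa using h

theorem braket_mulVec_self (g : SU2) (α : Spinor) :
    braket (g.1.mulVec α) (g.1.mulVec α) = braket α α := by
  obtain ⟨hu, -⟩ := Matrix.mem_specialUnitaryGroup_iff.mp g.2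
  rw [braket, braket, Matrix.star_mulVec, ← Matrix.dotProduct_mulVec, Matrix.mulVec_mulVec,
    ← Matrix.star_eq_conjTranspose, Matrix.mem_unitaryGroup_iff'.mp hu, Matrix.one_mulVec]

theorem map_mulVec_volume (g : SU2) :
    (volume : Measure Spinor).map (g.1.mulVec) = volume := by
  have : (volume : Measure Spinor).IsAddHaarMeasure := Measure.pi.isAddHaarMeasure _
  have hdet : LinearMap.det ((Matrix.toLin' g.1).restrictScalars ℝ) = 1 := by
    rw [LinearMap.det_restrictScalars, LinearMap.det_toLin',
      (Matrix.mem_specialUnitaryGroup_iff.mp g.2).2, map_one]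
  have h := Measure.map_linearMap_addHaar_eq_smul_addHaar (volume : Measure Spinor)
    (f := (Matrix.toLin' g.1).restrictScalars ℝ) (by rw [hdet]; exact one_ne_zero)
  rw [hdet, inv_one, abs_one, ENNReal.ofReal_one, one_smul] at h
  exact h

theorem map_mulVec_gaussianMeasure (g : SU2) : 
    gaussianMeasure.map (g.1.mulVec) = gaussianMeasure := by
  have hm : Measurable (g.1.mulVec) := by
    have : Continuous (g.1.mulVec) := by fun_prop
    exact this.measurable
  ext s hs
  have hd := continuous_gaussianDensity.measurable.ennreal_ofReal
  rw [Measure.map_apply hm hs, gaussianMeasure_eq, withDensity_apply _ (hm hs),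
    withDensity_apply _ hs]
  conv_rhs => rw [← map_mulVec_volume g]
  rw [setLIntegral_map hs hd hm]
  simp only [gaussianDensity, braket_mulVec_self]

theorem exists_SU2_smul_mulVec (α : Spinor) :
    ∃ k : SU2, α = (radius α : ℂ) • k.1.mulVec ![1, 0] := by
  by_cases h : radius α = 0
  · refine ⟨1, ?_⟩
    have h2 := radius_sq α
    rw [h, braket_self_re, Fin.sum_univ_two] at h2
    have h0 : ‖α 0‖ = 0 := by nlinarith [sq_nonneg ‖α 0‖, sq_nonneg ‖α 1‖]
    have h1 : ‖α 1‖ = 0 := by nlinarith [sq_nonneg ‖α 0‖, sq_nonneg ‖α 1‖]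
    rw [h]
    ext i
    fin_cases i
    · simpa using h0
    · simpa using h1
  · have hr : (radius α : ℂ) ≠ 0 := by exact_mod_cast h
    have hsq : star (α 0) * α 0 + star (α 1) * α 1 = (radius α : ℂ) ^ 2 := by
      have h2 := radius_sq α
      rw [braket_self_re, Fin.sum_univ_two] at h2
      rw [← Complex.ofReal_pow, h2]
      simp [Complex.conj_mul']
    -- The columns are `|α⟩` and `|α]`, divided by the radius.
    let K : Matrix (Fin 2) (Fin 2) ℂ :=
      !![α 0 / radius α, -star (α 1) / radius α; α 1 / radius α, star (α 0) / radius α]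
    have hK : K ∈ Matrix.specialUnitaryGroup (Fin 2) ℂ := by
      rw [Matrix.mem_specialUnitaryGroup_iff, Matrix.mem_unitaryGroup_iff]
      constructor
      · ext i j
        fin_cases i <;> fin_cases j <;>
          simp [K, Matrix.mul_apply, Fin.sum_univ_two, Matrix.star_apply] <;> field_simp <;>
          simp only [RCLike.star_def] at hsq <;> first | ring1 | linear_combination hsq
      · rw [Matrix.det_fin_two]
        simp [K]
        field_simp
        simp only [RCLike.star_def] at hsq
        linear_combination hsq
    refine ⟨⟨K, hK⟩, ?_⟩
    ext i
    fin_cases i <;> simp [K] <;> field_simp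

/-! ### The exponent of the Gaussian integrand, edge by edge -/

/-- The contribution `[z|α⟩⟨β|w⟩ - ⟨α|z⟩[w|β⟩` of an edge with labels `z, w` to the exponent. -/
def edgeForm (z w α β : Spinor) : ℂ := sqBraket z α * braket β w - braket α z * sqBraket w β

theorem continuous_edgeForm {X : Type*} [TopologicalSpace X] (z w : Spinor) {f g : X → Spinor}
    (hf : Continuous f) (hg : Continuous g) : Continuous fun x => edgeForm z w (f x) (g x) := by
  have hf' := fun k => (continuous_apply k).comp hf
  have hg' := fun k => (continuous_apply k).comp hg
  simp only [Function.comp_def] at hf' hg'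
  simp only [edgeForm, sqBraket_eq, braket, dotProduct, Fin.sum_univ_two, Pi.star_apply]
  have h0 := hf' 0
  have h1 := hf' 1
  have h2 := hg' 0
  have h3 := hg' 1
  fun_prop

/-- The scalars are real because each argument enters linearly in one summand and antilinearly in
the other. -/
theorem edgeForm_smul_smul (z w α β : Spinor) (r s : ℝ) :
    edgeForm z w ((r : ℂ) • α) ((s : ℂ) • β) = r * s * edgeForm z w α β := by
  simp [edgeForm, sqBraket_eq, braket, dotProduct, Fin.sum_univ_two]
  ring

/-- Insert `1 = |e⟩⟨e| + |e][e|` with `e = (1,0)` between `k` and `l⁻¹`. Elements of `SU(2)` commute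
with `|·⟩ ↦ |·]`, and the second summand becomes `[z|α][β|w⟩ = -⟨α|z⟩[w|β⟩`. -/
theorem sqBraket_mul_inv_mulVec (z w : Spinor) (k l : SU2) :
    sqBraket z ((k * l⁻¹ : SU2).1.mulVec w) =
      edgeForm z w (k.1.mulVec ![1, 0]) (l.1.mulVec ![1, 0]) := by
  have hkl : (k * l⁻¹ : SU2).1 = k.1 * star l.1 := rfl
  simp [hkl, edgeForm, sqBraket_eq, braket, dotProduct, Fin.sum_univ_two,
    Matrix.mul_apply, SU2.apply_zero_one, SU2.apply_one_one]
  ring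

theorem norm_edgeForm_le (z w α β : Spinor) :
    ‖edgeForm z w α β‖ ≤ 4 * (‖z‖ * ‖w‖) * ((braket α α).re + (braket β β).re) := by
  have hsq : ∀ a b : Spinor, ‖sqBraket a b‖ ≤ 2 * (‖a‖ * ‖b‖) := fun a b => by
    rw [sqBraket_eq]
    refine (norm_sub_le _ _).trans ?_
    rw [norm_mul, norm_mul, two_mul]
    gcongr <;> exact norm_le_pi_norm _ _
  have hbr : ∀ a b : Spinor, ‖braket a b‖ ≤ 2 * (‖a‖ * ‖b‖) := fun a b => by
    rw [braket, dotProduct, Fin.sum_univ_two]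
    refine (norm_add_le _ _).trans ?_
    rw [norm_mul, norm_mul, two_mul, Pi.star_apply, Pi.star_apply, norm_star, norm_star]
    gcongr <;> exact norm_le_pi_norm _ _
  have hn : ∀ a : Spinor, ‖a‖ ^ 2 ≤ (braket a a).re := fun a => by
    rw [← radius_sq]
    gcongr
    refine (pi_norm_le_iff_of_nonneg (radius_nonneg a)).mpr fun k => ?_
    rw [radius, braket_self_re]
    refine Real.le_sqrt_of_sq_le ?_
    exact Finset.single_le_sum (f := fun k => ‖a k‖ ^ 2) (fun _ _ => by positivity)
      (Finset.mem_univ k)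
  calc ‖edgeForm z w α β‖
      ≤ ‖sqBraket z α‖ * ‖braket β w‖ + ‖braket α z‖ * ‖sqBraket w β‖ := by
        rw [← norm_mul, ← norm_mul]
        exact norm_sub_le _ _
    _ ≤ (2 * (‖z‖ * ‖α‖)) * (2 * (‖β‖ * ‖w‖)) + (2 * (‖α‖ * ‖z‖)) * (2 * (‖w‖ * ‖β‖)) := by
        exact add_le_add
          (mul_le_mul (hsq z α) (hbr β w) (norm_nonneg _) (by positivity))
          (mul_le_mul (hbr α z) (hsq w β) (norm_nonneg _) (by positivity))
    _ = 4 * (‖z‖ * ‖w‖) * (2 * ‖α‖ * ‖β‖) := by ring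
    _ ≤ 4 * (‖z‖ * ‖w‖) * ((braket α α).re + (braket β β).re) := by
        gcongr
        exact (two_mul_le_add_sq _ _).trans (add_le_add (hn α) (hn β))

section Graph

variable {V E : Type*} (src tgt : E → V) (z : Labels E)

/-- The contribution of an edge of the graph to the exponent of the Gaussian integrand. -/
def edgeTerm (e : E) (α : V → Spinor) : ℂ :=
  edgeForm (z.1 e) (z.2 e) (α (src e)) (α (tgt e))

theorem continuous_edgeTerm (e : E) : Continuous (edgeTerm src tgt z e) :=
  continuous_edgeForm _ _ (continuous_apply _) (continuous_apply _)

/-- Each edge meets exactly one pair `(i, j)` in each of the two sums defining `X_ij`: `(s_e, t_e)`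
in the first, `(t_e, s_e)` in the second. These give the two summands of `edgeForm`. -/
theorem sum_braket_blockX_eq_sum_edgeTerm [Fintype V] [DecidableEq V] [Fintype E] (α : V → Spinor) :
    -(∑ i, ∑ j, braket (α i) ((blockX src tgt z i j).mulVec (α j))) =
      ∑ e, edgeTerm src tgt z e α := by
  have hblock : ∀ i j, braket (α i) ((blockX src tgt z i j).mulVec (α j)) =
      (∑ e, if src e = i ∧ tgt e = j then sqBraket (z.2 e) (α j) * braket (α i) (z.1 e) else 0) -
      ∑ e, if tgt e = i ∧ src e = j then sqBraket (z.1 e) (α j) * braket (α i) (z.2 e) else 0 := by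
    intro i j
    rw [blockX, Matrix.sub_mulVec, Matrix.sum_mulVec, Matrix.sum_mulVec, braket, dotProduct_sub,
      dotProduct_sum, dotProduct_sum, Finset.sum_filter, Finset.sum_filter]
    simp only [ketSqBra_mulVec, dotProduct_smul, smul_eq_mul, braket]
  have hsum : ∀ (s t : E → V) (f : E → V → V → ℂ),
      ∑ i, ∑ j, ∑ e, (if s e = i ∧ t e = j then f e i j else 0) = ∑ e, f e (s e) (t e) := by
    intro s t f
    calc _ = ∑ i, ∑ e, ∑ j, (if s e = i ∧ t e = j then f e i j else 0) :=
          Finset.sum_congr rfl fun i _ => Finset.sum_comm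
      _ = ∑ e, ∑ i, ∑ j, (if s e = i ∧ t e = j then f e i j else 0) := Finset.sum_comm
      _ = _ := Finset.sum_congr rfl fun e _ => by
          simp only [ite_and, Finset.sum_ite_irrel, Finset.sum_const_zero, Finset.sum_ite_eq,
            Finset.mem_univ, if_true]
  simp only [hblock, Finset.sum_sub_distrib]
  rw [hsum src tgt fun e i j => sqBraket (z.2 e) (α j) * braket (α i) (z.1 e),
    hsum tgt src fun e i j => sqBraket (z.1 e) (α j) * braket (α i) (z.2 e), neg_sub,
    ← Finset.sum_sub_distrib]
  refine Finset.sum_congr rfl fun e _ => ?_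
  simp only [edgeTerm, edgeForm]
  ring

/-- Twice the sum `J_v` of the spins at a vertex. -/
def vertexDegree [DecidableEq V] [Fintype E] (d : E → ℕ) (v : V) : ℕ :=
  (∑ e with src e = v, d e) + ∑ e with tgt e = v, d e

theorem vertexSpin_eq [DecidableEq V] [Fintype E] (d : E → ℕ) (v : V) :
    vertexSpin src tgt d v = (vertexDegree src tgt d v : ℝ) / 2 := by
  rw [vertexSpin, vertexDegree, ← Finset.sum_div, ← Finset.sum_div, ← add_div]
  push_cast
  rfl

/-- A loop counts twice at its vertex on both sides. -/
theorem prod_pow_mul_pow [Fintype V] [DecidableEq V] [Fintype E] (r : V → ℂ) (d : E → ℕ) :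
    ∏ e, (r (src e) * r (tgt e)) ^ d e = ∏ v, r v ^ vertexDegree src tgt d v := by
  simp only [mul_pow, Finset.prod_mul_distrib, vertexDegree, pow_add, ← Finset.prod_pow_eq_pow_sum]
  congr 1
  · rw [← Finset.prod_fiberwise (s := Finset.univ) (g := src)]
    exact Finset.prod_congr rfl fun v _ => Finset.prod_congr rfl fun e he => by
      rw [(Finset.mem_filter.mp he).2]
  · rw [← Finset.prod_fiberwise (s := Finset.univ) (g := tgt)]
    exact Finset.prod_congr rfl fun v _ => Finset.prod_congr rfl fun e he => by
      rw [(Finset.mem_filter.mp he).2]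

/-! ### Haar averages as Gaussian moments. -/

/-- The summand of spins `j_e = d e / 2` in the expansion of the Gaussian integrand. -/
def edgeMonomial [Fintype E] (d : E → ℕ) (α : V → Spinor) : ℂ :=
  ∏ e, edgeTerm src tgt z e α ^ d e / ((d e).factorial : ℂ)

/-- The integrand of the coherent amplitude. -/
def amplitudeIntegrand [Fintype E] (d : E → ℕ) (g : V → SU2) : ℂ :=
  ∏ e, (sqBraket (z.1 e) ((g (src e) * (g (tgt e))⁻¹ : SU2).1.mulVec (z.2 e))) ^ d e
      / ((d e).factorial : ℂ)

theorem continuous_edgeMonomial [Fintype E] (d : E → ℕ) :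
    Continuous (edgeMonomial src tgt z d) := by
  have := continuous_edgeTerm src tgt z
  unfold edgeMonomial
  fun_prop

theorem amplitudeIntegrand_eq [Fintype E] (d : E → ℕ) (g : V → SU2) :
    amplitudeIntegrand src tgt z d g =
      edgeMonomial src tgt z d fun v => (g v).1.mulVec ![1, 0] := by
  simp only [amplitudeIntegrand, edgeMonomial, edgeTerm, sqBraket_mul_inv_mulVec]

theorem edgeMonomial_smul [Fintype V] [DecidableEq V] [Fintype E] (d : E → ℕ) (r : V → ℝ)
    (α : V → Spinor) :
    edgeMonomial src tgt z d (fun v => (r v : ℂ) • α v) =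
      (∏ v, (r v : ℂ) ^ vertexDegree src tgt d v) * edgeMonomial src tgt z d α := by
  rw [← prod_pow_mul_pow src tgt (fun v => (r v : ℂ)), edgeMonomial, edgeMonomial,
    ← Finset.prod_mul_distrib]
  refine Finset.prod_congr rfl fun e _ => ?_
  rw [edgeTerm, edgeForm_smul_smul, mul_pow, mul_div_assoc]
  rfl

theorem continuous_amplitudeIntegrand [Fintype E] (d : E → ℕ) :
    Continuous (amplitudeIntegrand src tgt z d) := by
  have h : Continuous fun g : V → SU2 => fun v => (g v).1.mulVec ![1, 0] :=
    continuous_pi fun v => (continuous_coe_SU2.comp (continuous_apply v)).matrix_mulVec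
      continuous_const
  simp only [funext (amplitudeIntegrand_eq src tgt z d)]
  exact (continuous_edgeMonomial src tgt z d).comp h

theorem exists_norm_amplitudeIntegrand_le [Fintype E] (d : E → ℕ) :
    ∃ C, ∀ g, ‖amplitudeIntegrand src tgt z d g‖ ≤ C := by
  obtain ⟨C, hC⟩ := isCompact_univ.exists_bound_of_continuousOn
    (continuous_amplitudeIntegrand src tgt z d).continuousOn
  exact ⟨C, fun g => hC g (Set.mem_univ g)⟩

/-- Every configuration of spinors is a rescaled rotation of the reference spinor. -/
theorem exists_edgeMonomial_rotate_eq [Fintype V] [DecidableEq V] [Fintype E] (d : E → ℕ)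
    (α : V → Spinor) :
    ∃ k : V → SU2, ∀ g : V → SU2, edgeMonomial src tgt z d (fun v => (g v).1.mulVec (α v)) =
      (∏ v, (radius (α v) : ℂ) ^ vertexDegree src tgt d v) *
        amplitudeIntegrand src tgt z d (g * k) := by
  choose k hk using fun v => exists_SU2_smul_mulVec (α v)
  refine ⟨k, fun g => ?_⟩
  rw [amplitudeIntegrand_eq, ← edgeMonomial_smul src tgt z d (fun v => radius (α v))]
  congr 1
  funext v
  conv_lhs => rw [hk v]
  rw [Matrix.mulVec_smul, Matrix.mulVec_mulVec]
  rfl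

theorem integral_pi_haarSU2_mul_right [Fintype V] (k : V → SU2) (f : (V → SU2) → ℂ)
    (hf : Continuous f) :
    ∫ g, f (g * k) ∂(Measure.pi fun _ : V => haarSU2) =
      ∫ g, f g ∂(Measure.pi fun _ : V => haarSU2) := by
  have hm : ∀ v, AEMeasurable (fun g : SU2 => g * k v) haarSU2 := fun v =>
    (measurable_mul_const (k v)).aemeasurable
  have hfin : ∀ v, SigmaFinite (haarSU2.map (· * k v)) := fun v => by
    rw [map_mul_right_haarSU2]
    infer_instance
  have h := Measure.pi_map_pi (μ := fun _ : V => haarSU2) (f := fun v g => g * k v) hm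
  simp only [map_mul_right_haarSU2] at h
  conv_rhs => rw [← h]
  rw [integral_map _ hf.aestronglyMeasurable]
  · rfl
  · exact (measurable_pi_lambda _ fun v =>
      (measurable_mul_const (k v)).comp (measurable_pi_apply v)).aemeasurable

theorem integral_pi_gaussianMeasure_mulVec [Fintype V] (g : V → SU2) (f : (V → Spinor) → ℂ)
    (hf : Continuous f) :
    ∫ α, f (fun v => (g v).1.mulVec (α v)) ∂(Measure.pi fun _ : V => gaussianMeasure) =
      ∫ α, f α ∂(Measure.pi fun _ : V => gaussianMeasure) := by
  have hc : ∀ v, Continuous (g v).1.mulVec := fun v => by fun_prop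
  have hfin : ∀ v, SigmaFinite (gaussianMeasure.map (g v).1.mulVec) := fun v => by
    rw [map_mulVec_gaussianMeasure]
    infer_instance
  have h := Measure.pi_map_pi (μ := fun _ : V => gaussianMeasure)
    (f := fun v => (g v).1.mulVec) fun v => (hc v).aemeasurable
  simp only [map_mulVec_gaussianMeasure] at h
  conv_rhs => rw [← h]
  rw [integral_map _ hf.aestronglyMeasurable]
  exact (continuous_pi fun v => (hc v).comp (continuous_apply v)).aemeasurable

theorem integrable_prod_radius_pow [Fintype V] (n : V → ℕ) :
    Integrable (fun α : V → Spinor => ∏ v, radius (α v) ^ n v)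
      (Measure.pi fun _ => gaussianMeasure) :=
  Integrable.fintype_prod (f := fun v (β : Spinor) => radius β ^ n v)
    fun v => integrable_radius_pow (n v)

/-- This justifies Fubini: the monomial is bounded by a product of radial powers times the supremum
of the amplitude integrand over a compact group. -/
theorem integrable_edgeMonomial_rotate [Fintype V] [DecidableEq V] [Fintype E] (d : E → ℕ) :
    Integrable (fun p : (V → SU2) × (V → Spinor) =>
        edgeMonomial src tgt z d fun v => (p.1 v).1.mulVec (p.2 v))
      ((Measure.pi fun _ => haarSU2).prod (Measure.pi fun _ => gaussianMeasure)) := by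
  obtain ⟨C, hC⟩ := exists_norm_amplitudeIntegrand_le src tgt z d
  have hb := ((integrable_prod_radius_pow (vertexDegree src tgt d)).mul_const C).comp_snd
    (Measure.pi fun _ : V => haarSU2)
  refine hb.mono' (Continuous.aestronglyMeasurable ?_) (ae_of_all _ fun p => ?_)
  · refine (continuous_edgeMonomial src tgt z d).comp (continuous_pi fun v => ?_)
    exact (continuous_coe_SU2.comp ((continuous_apply v).comp continuous_fst)).matrix_mulVec
      ((continuous_apply v).comp continuous_snd)
  · obtain ⟨k, hk⟩ := exists_edgeMonomial_rotate_eq src tgt z d p.2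
    rw [hk, norm_mul, norm_prod]
    simp only [norm_pow, Complex.norm_real, Real.norm_of_nonneg (radius_nonneg _)]
    exact mul_le_mul_of_nonneg_left (hC _)
      (Finset.prod_nonneg fun v _ => pow_nonneg (radius_nonneg _) _)

theorem integrable_edgeMonomial [Fintype V] [DecidableEq V] [Fintype E] (d : E → ℕ) :
    Integrable (edgeMonomial src tgt z d) (Measure.pi fun _ : V => gaussianMeasure) := by
  obtain ⟨C, hC⟩ := exists_norm_amplitudeIntegrand_le src tgt z d
  refine ((integrable_prod_radius_pow (vertexDegree src tgt d)).mul_const C).mono'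
    (continuous_edgeMonomial src tgt z d).aestronglyMeasurable (ae_of_all _ fun α => ?_)
  obtain ⟨k, hk⟩ := exists_edgeMonomial_rotate_eq src tgt z d α
  have h1 := hk 1
  simp only [Pi.one_apply, OneMemClass.coe_one, Matrix.one_mulVec] at h1
  rw [h1, norm_mul, norm_prod]
  simp only [norm_pow, Complex.norm_real, Real.norm_of_nonneg (radius_nonneg _)]
  exact mul_le_mul_of_nonneg_left (hC _)
    (Finset.prod_nonneg fun v _ => pow_nonneg (radius_nonneg _) _)

theorem integral_prod_radius_pow [Fintype V] (n : V → ℕ) :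
    ∫ α : V → Spinor, ∏ v, (radius (α v) : ℂ) ^ n v ∂(Measure.pi fun _ => gaussianMeasure) =
      ∏ v, (Real.Gamma (n v / 2 + 2) : ℂ) := by
  rw [integral_fintype_prod_eq_prod (f := fun v (β : Spinor) => (radius β : ℂ) ^ n v)]
  refine Finset.prod_congr rfl fun v _ => ?_
  rw [← integral_radius_pow]
  exact_mod_cast integral_ofReal (𝕜 := ℂ) (μ := gaussianMeasure) (f := fun β => radius β ^ n v)

/-- Integration over `SU(2)` is traded for Gaussian integration over spinors. -/
theorem genTerm_eq_integral [Fintype V] [DecidableEq V] [Fintype E] (d : E → ℕ) :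
    genTerm src tgt z d =
      ∫ α, edgeMonomial src tgt z d α ∂(Measure.pi fun _ : V => gaussianMeasure) := by
  symm
  have hinner : ∀ α : V → Spinor,
      ∫ g : V → SU2, edgeMonomial src tgt z d (fun v => (g v).1.mulVec (α v))
          ∂(Measure.pi fun _ => haarSU2) =
        (∏ v, (radius (α v) : ℂ) ^ vertexDegree src tgt d v) * amplitude src tgt z d := by
    intro α
    obtain ⟨k, hk⟩ := exists_edgeMonomial_rotate_eq src tgt z d α
    simp only [hk]
    rw [integral_const_mul, integral_pi_haarSU2_mul_right _ _
      (continuous_amplitudeIntegrand src tgt z d)]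
    rfl
  -- Rotation invariance of the Gaussian allows averaging over all `g` at no cost. After the swap,
  -- right invariance of Haar measure removes the rotation `k` that depends on `α`, so only radial
  -- powers remain in `α`.
  calc ∫ α, edgeMonomial src tgt z d α ∂(Measure.pi fun _ : V => gaussianMeasure)
      = ∫ g : V → SU2, (∫ α, edgeMonomial src tgt z d (fun v => (g v).1.mulVec (α v))
          ∂(Measure.pi fun _ : V => gaussianMeasure)) ∂(Measure.pi fun _ => haarSU2) := by
        simp only [integral_pi_gaussianMeasure_mulVec _ _ (continuous_edgeMonomial src tgt z d)]
        simp
    _ = ∫ α, (∫ g : V → SU2, edgeMonomial src tgt z d (fun v => (g v).1.mulVec (α v))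
          ∂(Measure.pi fun _ => haarSU2)) ∂(Measure.pi fun _ : V => gaussianMeasure) :=
        integral_integral_swap (integrable_edgeMonomial_rotate src tgt z d)
    _ = genTerm src tgt z d := by
        simp only [hinner]
        rw [integral_mul_const, integral_prod_radius_pow, genTerm]
        simp only [vertexSpin_eq]

end Graph

/-! ### Expansion of the Gaussian integral -/

/-- A finite product of absolutely convergent series is an absolutely convergent multiple series. -/
theorem hasSum_prod_of_summable_norm {R : Type*} [NormedCommRing R] [CompleteSpace R]
    (ι : Type*) [h_fintype : Fintype ι] (f : ι → ℕ → R) (a : ι → R) (hf : ∀ i, HasSum (f i) (a i))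
    (hn : ∀ i, Summable fun n => ‖f i n‖) :
    HasSum (fun d : ι → ℕ => ∏ i, f i (d i)) (∏ i, a i) ∧
      Summable fun d : ι → ℕ => ‖∏ i, f i (d i)‖ := by
  revert f a
  refine Fintype.induction_empty_option ?_ ?_ ?_ ι (h_fintype := h_fintype)
  · intro α β _ e ih f a hf hn
    let _ := Fintype.ofEquiv β e.symm
    obtain ⟨h1, h2⟩ := ih (fun i => f (e i)) (fun i => a (e i)) (fun i => hf _) fun i => hn _
    have hφ : ∀ d : β → ℕ, ∏ i, f i (d i) =
        (fun d : α → ℕ => ∏ i, f (e i) (d i)) (e.symm.arrowCongr (Equiv.refl ℕ) d) := fun d => by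
      simp only [Equiv.arrowCongr_apply, Equiv.coe_refl, Function.comp_apply, id, Equiv.symm_symm]
      exact (e.prod_comp fun i => f i (d i)).symm
    have ha : ∏ i, a i = ∏ i, a (e i) := (e.prod_comp a).symm
    simp only [hφ, ha]
    exact ⟨(e.symm.arrowCongr (Equiv.refl ℕ)).hasSum_iff.mpr h1,
      (e.symm.arrowCongr (Equiv.refl ℕ)).summable_iff
        (f := fun d : α → ℕ => ‖∏ i, f (e i) (d i)‖) |>.mpr h2⟩
  · intro f a _ _
    refine ⟨?_, Summable.of_finite⟩
    simp
  · intro α _ ih f a hf hn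
    obtain ⟨h1, h2⟩ := ih (fun i => f (some i)) (fun i => a (some i)) (fun i => hf _)
      fun i => hn _
    set g : (α → ℕ) → R := fun d => ∏ i, f (some i) (d i)
    let G : ℕ × (α → ℕ) → R := fun p => f none p.1 * g p.2
    obtain ⟨φ, hφ⟩ : ∃ φ : (Option α → ℕ) ≃ ℕ × (α → ℕ),
        ∀ d, φ d = (d none, fun i => d (some i)) := ⟨Equiv.piOptionEquivProd, fun _ => rfl⟩
    have hG : (fun d : Option α → ℕ => ∏ i, f i (d i)) = G ∘ φ := funext fun d => by
      rw [Function.comp_apply, hφ, Fintype.prod_option]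
    have h3 : HasSum G (a none * ∏ i, a (some i)) :=
      HasSum.mul (hf none) h1
        (summable_mul_of_summable_norm (f := f none) (g := g) (hn none) h2)
    have h4 : Summable fun p => ‖G p‖ := Summable.mul_norm (f := f none) (g := g) (hn none) h2
    refine ⟨?_, ?_⟩
    · rw [hG, Fintype.prod_option]
      exact (φ.hasSum_iff (f := G)).mpr h3
    · have h5 : (fun d : Option α → ℕ => ‖∏ i, f i (d i)‖) = (fun p => ‖G p‖) ∘ φ :=
        funext fun d => congrArg norm (congrFun hG d)
      rw [h5]
      exact (φ.summable_iff (f := fun p => ‖G p‖)).mpr h4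

theorem hasSum_prod_pow_div_factorial {ι : Type*} [Fintype ι] (x : ι → ℂ) :
    HasSum (fun d : ι → ℕ => ∏ i, x i ^ d i / ((d i).factorial : ℂ)) (Complex.exp (∑ i, x i)) := by
  rw [Complex.exp_sum]
  refine (hasSum_prod_of_summable_norm ι (fun i n => x i ^ n / (n.factorial : ℂ)) _
    (fun i => ?_) fun i => NormedSpace.norm_expSeries_div_summable (x i)).1
  rw [Complex.exp_eq_exp_ℂ]
  exact NormedSpace.expSeries_div_hasSum_exp (x i)

theorem hasSum_prod_pow_div_factorial_real {ι : Type*} [Fintype ι] (x : ι → ℝ) :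
    HasSum (fun d : ι → ℕ => ∏ i, x i ^ d i / ((d i).factorial : ℝ)) (Real.exp (∑ i, x i)) := by
  rw [Real.exp_sum]
  refine (hasSum_prod_of_summable_norm ι (fun i n => x i ^ n / (n.factorial : ℝ)) _
    (fun i => ?_) fun i => NormedSpace.norm_expSeries_div_summable (x i)).1
  rw [Real.exp_eq_exp_ℝ]
  exact NormedSpace.expSeries_div_hasSum_exp (x i)

section Graph

variable {V E : Type*} [Fintype E] (src tgt : E → V) (z : Labels E)

/-- The exponent of the Gaussian integrand is dominated by half of the Gaussian weight. -/
def ExponentBound [Fintype V] : Prop :=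
  ∀ α : V → Spinor, ∑ e, ‖edgeTerm src tgt z e α‖ ≤ 1 / 2 * ∑ v, (braket (α v) (α v)).re

variable {src tgt z}

/-- Only the product of the two norms matters, so shrinking `z.1` alone suffices. The `8` is the `4`
of `norm_edgeForm_le` doubled, each endpoint weight being at most `S`. -/
theorem exponentBound_of_norm_le [Fintype V] (h : 8 * Fintype.card E * (‖z.1‖ * ‖z.2‖) ≤ 1 / 2) :
    ExponentBound src tgt z := by
  intro α
  set S := ∑ v, (braket (α v) (α v)).re with hS
  have hS0 : 0 ≤ S := Finset.sum_nonneg fun v _ => braket_self_re_nonneg _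
  have hle : ∀ v, (braket (α v) (α v)).re ≤ S := fun v =>
    Finset.single_le_sum (f := fun v => (braket (α v) (α v)).re)
      (fun v _ => braket_self_re_nonneg _) (Finset.mem_univ v)
  have he : ∀ e, ‖edgeTerm src tgt z e α‖ ≤ 4 * (‖z.1‖ * ‖z.2‖) * (S + S) := fun e => by
    refine (norm_edgeForm_le _ _ _ _).trans ?_
    have h1 := norm_le_pi_norm z.1 e
    have h2 := norm_le_pi_norm z.2 e
    have h3 := hle (src e)
    have h4 := hle (tgt e)
    have h5 := braket_self_re_nonneg (α (src e))
    have h6 := braket_self_re_nonneg (α (tgt e))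
    gcongr
  calc ∑ e, ‖edgeTerm src tgt z e α‖ ≤ ∑ _e : E, 4 * (‖z.1‖ * ‖z.2‖) * (S + S) :=
        Finset.sum_le_sum fun e _ => he e
    _ = 8 * Fintype.card E * (‖z.1‖ * ‖z.2‖) * S := by
        rw [Finset.sum_const, Finset.card_univ, nsmul_eq_mul]
        ring
    _ ≤ 1 / 2 * S := by gcongr

theorem eventually_exponentBound [Fintype V] (src tgt : E → V) :
    ∀ᶠ z : Labels E in 𝓝 0, ExponentBound src tgt z := by
  have hc : Continuous fun z : Labels E => 8 * (Fintype.card E : ℝ) * (‖z.1‖ * ‖z.2‖) := by fun_prop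
  have h := hc.tendsto 0
  simp only [Prod.fst_zero, norm_zero, zero_mul, mul_zero] at h
  filter_upwards [h.eventually (gt_mem_nhds (by norm_num : (0 : ℝ) < 1 / 2))] with z hz
  exact exponentBound_of_norm_le hz.le

theorem star_dotProduct_one_add_matrixX [Fintype V] [DecidableEq V] (a : V × Fin 2 → ℂ) :
    star a ⬝ᵥ (1 + matrixX src tgt z).mulVec a =
      ((∑ v, (braket (Function.curry a v) (Function.curry a v)).re : ℝ) : ℂ) -
        ∑ e, edgeTerm src tgt z e (Function.curry a) := by
  rw [← sum_braket_blockX_eq_sum_edgeTerm, sum_braket_blockX, ← sum_braket_self,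
    Function.uncurry_curry, Matrix.add_mulVec, Matrix.one_mulVec, dotProduct_add, sub_neg_eq_add]

/-- The form of the Hermitian part is the real part of `⟨a|1+X|a⟩`, which the bound keeps above half
of `⟨a|a⟩`. -/
theorem ExponentBound.hermPartPosDef [Fintype V] [DecidableEq V] (h : ExponentBound src tgt z) :
    HermPartPosDef src tgt z := by
  set M := 1 + matrixX src tgt z with hM
  refine Matrix.PosDef.of_dotProduct_mulVec_pos ?_ fun a ha => ?_
  · rw [Matrix.IsHermitian, Matrix.conjTranspose_smul, Matrix.conjTranspose_add,
      Matrix.conjTranspose_conjTranspose, add_comm]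
    simp
  · have hre : star a ⬝ᵥ ((1 / 2 : ℂ) • (M + M.conjTranspose)).mulVec a =
        ((star a ⬝ᵥ M.mulVec a).re : ℂ) := by
      have hst : star a ⬝ᵥ M.conjTranspose.mulVec a = star (star a ⬝ᵥ M.mulVec a) := by
        rw [Matrix.star_dotProduct, Matrix.star_mulVec, Matrix.conjTranspose_conjTranspose,
          ← Matrix.dotProduct_mulVec]
      rw [Matrix.smul_mulVec, dotProduct_smul, Matrix.add_mulVec, dotProduct_add, hst,
        RCLike.star_def, Complex.add_conj, smul_eq_mul]
      push_cast
      ring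
    rw [hre, hM, star_dotProduct_one_add_matrixX, Complex.sub_re, Complex.ofReal_re]
    set α := Function.curry a
    have hpos : 0 < ∑ v, (braket (α v) (α v)).re := by
      obtain ⟨p, hp⟩ := Function.ne_iff.mp ha
      refine Finset.sum_pos' (fun v _ => braket_self_re_nonneg _) ⟨p.1, Finset.mem_univ _, ?_⟩
      rw [braket_self_re]
      refine Finset.sum_pos' (fun k _ => by positivity) ⟨p.2, Finset.mem_univ _, ?_⟩
      have : 0 < ‖a p‖ := norm_pos_iff.mpr hp
      exact pow_pos this 2
    have hle : (∑ e, edgeTerm src tgt z e α).re ≤ 1 / 2 * ∑ v, (braket (α v) (α v)).re :=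
      (Complex.re_le_norm _).trans ((norm_sum_le _ _).trans (h α))
    exact_mod_cast (by linarith : 0 < _ - (∑ e, edgeTerm src tgt z e α).re)

theorem norm_edgeMonomial (d : E → ℕ) (α : V → Spinor) :
    ‖edgeMonomial src tgt z d α‖ =
      ∏ e, ‖edgeTerm src tgt z e α‖ ^ d e / ((d e).factorial : ℝ) := by
  simp [edgeMonomial, norm_prod]

theorem integrable_exp_half_braket [Fintype V] :
    Integrable (fun α : V → Spinor => Real.exp (1 / 2 * ∑ v, (braket (α v) (α v)).re))
      (Measure.pi fun _ => gaussianMeasure) := by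
  simp only [Finset.mul_sum, Real.exp_sum]
  refine Integrable.fintype_prod (f := fun _ (β : Spinor) => Real.exp (1 / 2 * (braket β β).re))
    fun _ => (integrable_gaussianMeasure_iff _).mpr ?_
  refine ((integrable_exp_neg_mul_braket one_half_pos).div_const (Real.pi ^ 2)).congr
    (ae_of_all _ fun β => ?_)
  simp only [gaussianDensity]
  rw [div_mul_eq_mul_div (Real.exp _), ← Real.exp_add]
  congr 2
  ring

theorem ExponentBound.hasSum_genTerm [Fintype V] [DecidableEq V] (h : ExponentBound src tgt z) :
    HasSum (genTerm src tgt z) (gaussianIntegral src tgt z) := by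
  have hs : Summable fun d : E → ℕ => ∫ α, ‖edgeMonomial src tgt z d α‖
      ∂(Measure.pi fun _ : V => gaussianMeasure) := by
    -- One bound serves all partial sums: the absolute series sums pointwise to the exponential of
    -- `∑ ‖edgeTerm‖`, which is at most `exp (½ ∑ ⟨α|α⟩)` and hence integrable against the Gaussian.
    refine summable_of_sum_le (c := ∫ α, Real.exp (1 / 2 * ∑ v, (braket (α v) (α v)).re)
        ∂(Measure.pi fun _ : V => gaussianMeasure))
      (fun d => integral_nonneg fun α => norm_nonneg _) fun u => ?_
    rw [← integral_finsetSum _ fun d _ => (integrable_edgeMonomial src tgt z d).norm]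
    refine integral_mono (integrable_finsetSum _ fun d _ =>
      (integrable_edgeMonomial src tgt z d).norm) integrable_exp_half_braket fun α => ?_
    simp only [norm_edgeMonomial]
    exact (sum_le_hasSum u (fun d _ => Finset.prod_nonneg fun e _ => by positivity)
      (hasSum_prod_pow_div_factorial_real _)).trans (Real.exp_le_exp.mpr (h α))
  have := hasSum_integral_of_summable_integral_norm (integrable_edgeMonomial src tgt z) hs
  simp only [← genTerm_eq_integral] at this
  convert! this using 1
  refine integral_congr_ae (ae_of_all _ fun α => ?_)
  simp only [gaussianIntegrand]
  rw [sum_braket_blockX_eq_sum_edgeTerm]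
  exact (hasSum_prod_pow_div_factorial fun e => edgeTerm src tgt z e α).tsum_eq.symm

/-! ### Evaluation wherever the series converges -/

/-- Scaling only one label per edge makes `t` enter with power `∑ d e` here and linearly in `X`. -/
theorem genTerm_smul_fst [Fintype V] [DecidableEq V] (t : ℂ) (d : E → ℕ) :
    genTerm src tgt (t • z.1, z.2) d = t ^ (∑ e, d e) * genTerm src tgt z d := by
  have h : ∀ g : V → SU2, amplitudeIntegrand src tgt (t • z.1, z.2) d g =
      t ^ (∑ e, d e) * amplitudeIntegrand src tgt z d g := fun g => by
    rw [amplitudeIntegrand, amplitudeIntegrand, ← Finset.prod_pow_eq_pow_sum,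
      ← Finset.prod_mul_distrib]
    refine Finset.prod_congr rfl fun e _ => ?_
    rw [← mul_div_assoc, ← mul_pow]
    congr 2
    simp only [sqBraket_eq, Pi.smul_apply, smul_eq_mul]
    ring
  have ha : amplitude src tgt (t • z.1, z.2) d = t ^ (∑ e, d e) * amplitude src tgt z d := by
    rw [amplitude, amplitude, ← integral_const_mul]
    exact integral_congr_ae (ae_of_all _ h)
  rw [genTerm, genTerm, ha]
  ring

theorem star_contra (w : Spinor) : star (contra w) = ![-w 1, w 0] := by
  ext i
  fin_cases i <;> simp [contra]

theorem ketSqBra_apply (z w : Spinor) (k l : Fin 2) :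
    ketSqBra z w k l = z k * (![-w 1, w 0] : Spinor) l := by
  rw [ketSqBra, Matrix.vecMulVec_apply, star_contra]

theorem ketSqBra_smul_left (t : ℂ) (z w : Spinor) : ketSqBra (t • z) w = t • ketSqBra z w := by
  ext k l
  simp only [ketSqBra_apply, Pi.smul_apply, Matrix.smul_apply, smul_eq_mul]
  ring

theorem ketSqBra_smul_right (t : ℂ) (z w : Spinor) : ketSqBra z (t • w) = t • ketSqBra z w := by
  ext k l
  fin_cases l <;> simp [ketSqBra_apply] <;> ring

theorem matrixX_smul_fst [DecidableEq V] (t : ℂ) :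
    matrixX src tgt (t • z.1, z.2) = t • matrixX src tgt z := by
  ext p q
  simp only [matrixX, Matrix.of_apply, Matrix.smul_apply, blockX, Pi.smul_apply,
    ketSqBra_smul_left, ketSqBra_smul_right, ← Finset.smul_sum, ← smul_sub]

theorem matrixX_smul [DecidableEq V] (t : ℂ) :
    matrixX src tgt (t • z) = t ^ 2 • matrixX src tgt z := by
  ext p q
  simp only [matrixX, Matrix.of_apply, Matrix.smul_apply, blockX, Prod.smul_fst, Prod.smul_snd,
    Pi.smul_apply, ketSqBra_smul_left, ketSqBra_smul_right, ← Finset.smul_sum, ← smul_sub,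
    smul_smul, pow_two]

theorem differentiable_det_one_add_smul {n : Type*} [Fintype n] [DecidableEq n] (M : Matrix n n ℂ) :
    Differentiable ℂ fun t : ℂ => (1 + t • M).det := by
  simp only [Matrix.det_apply, Matrix.add_apply, Matrix.smul_apply]
  fun_prop

theorem detX_mul_genFunctional_of_summable [Fintype V] [DecidableEq V]
    (hz : Summable (genTerm src tgt z)) :
    genFunctional src tgt z * detX src tgt z = 1 := by
  set g : ℂ → ℂ := fun t => ∑' d : E → ℕ, t ^ (∑ e, d e) * genTerm src tgt z d with hg
  set p : ℂ → ℂ := fun t => (1 + t • matrixX src tgt z).det with hp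
  have hpd : Differentiable ℂ p := differentiable_det_one_add_smul _
  have hbound : ∀ (d : E → ℕ) (t : ℂ), t ∈ Metric.closedBall (0 : ℂ) 1 →
      ‖t ^ (∑ e, d e) * genTerm src tgt z d‖ ≤ ‖genTerm src tgt z d‖ := fun d t ht => by
    rw [norm_mul, norm_pow]
    exact mul_le_of_le_one_left (norm_nonneg _)
      (pow_le_one₀ (norm_nonneg _) (mem_closedBall_zero_iff.mp ht))
  -- Summability at `t = 1` dominates the whole closed disc, so `g` is continuous up to the
  -- boundary, where `t = 1` lies.
  have hgc : ContinuousOn g (Metric.closedBall 0 1) :=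
    continuousOn_tsum (fun d => by fun_prop) hz.norm hbound
  have hgd : DifferentiableOn ℂ g (Metric.ball 0 1) :=
    Complex.differentiableOn_tsum_of_summable_norm hz.norm (fun d => by fun_prop)
      Metric.isOpen_ball fun d t ht => hbound d t (Metric.ball_subset_closedBall ht)
  have hloc : ∀ᶠ t in 𝓝 (0 : ℂ), g t * p t = 1 := by
    have hc : Continuous fun t : ℂ => 8 * (Fintype.card E : ℝ) * (‖t • z.1‖ * ‖z.2‖) := by fun_prop
    have h := hc.tendsto 0
    simp only [zero_smul, norm_zero, zero_mul, mul_zero] at h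
    filter_upwards [h.eventually (gt_mem_nhds (by norm_num : (0 : ℝ) < 1 / 2))] with t ht
    have hb : ExponentBound src tgt (t • z.1, z.2) := exponentBound_of_norm_le ht.le
    obtain ⟨-, h0, h1⟩ := gaussianIntegral_of_hermPartPosDef src tgt _ hb.hermPartPosDef
    have hs := hb.hasSum_genTerm.tsum_eq
    simp only [genTerm_smul_fst] at hs
    have hdet : detX src tgt (t • z.1, z.2) = p t := by rw [detX, matrixX_smul_fst]
    rw [hg]
    simp only
    rw [hs, h1, ← hdet, one_div, inv_mul_cancel₀ h0]
  have hball : Set.EqOn (fun t => g t * p t) (fun _ => 1) (Metric.ball 0 1) :=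
    AnalyticOnNhd.eqOn_of_preconnected_of_eventuallyEq
      ((hgd.mul hpd.differentiableOn).analyticOnNhd Metric.isOpen_ball)
      analyticOnNhd_const (convex_ball _ _).isPreconnected (Metric.mem_ball_self one_pos) hloc
  have hclosed : Set.EqOn (fun t => g t * p t) (fun _ => 1) (Metric.closedBall 0 1) :=
    hball.of_subset_closure (hgc.mul hpd.continuous.continuousOn) continuousOn_const
      Metric.ball_subset_closedBall (closure_ball (0 : ℂ) one_ne_zero).symm.subset
  have h1 := hclosed (show (1 : ℂ) ∈ Metric.closedBall 0 1 by simp)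
  simpa [hg, hp, genFunctional, detX] using h1

/-! ### The domain of the analytic continuation -/

/-- `[w|` undoes the conjugation in `|w]`, so the entries of `X` are polynomials in the labels. -/
theorem analyticOnNhd_detX [Fintype V] [DecidableEq V] (src tgt : E → V) (s : Set (Labels E)) :
    AnalyticOnNhd ℂ (detX src tgt) s := by
  have hk : ∀ (e : E) (k l : Fin 2),
      ContDiff ℂ ⊤ (fun z : Labels E => ketSqBra (z.1 e) (z.2 e) k l) ∧
      ContDiff ℂ ⊤ (fun z : Labels E => ketSqBra (z.2 e) (z.1 e) k l) := fun e k l => by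
    simp only [ketSqBra_apply]
    fin_cases l <;> simp <;> constructor <;> fun_prop
  -- Here `⊤` is the analytic order of smoothness `ω`.
  have h : ContDiff ℂ ⊤ (detX src tgt) := by
    unfold detX
    simp only [Matrix.det_apply, Matrix.add_apply, matrixX, Matrix.of_apply, blockX,
      Matrix.sub_apply, Matrix.sum_apply]
    have h1 := fun e k l => (hk e k l).1
    have h2 := fun e k l => (hk e k l).2
    fun_prop
  exact (contDiff_omega_iff_analyticOnNhd.mp h).mono (Set.subset_univ s)

theorem detX_zero [Fintype V] [DecidableEq V] (src tgt : E → V) :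
    detX src tgt (0 : Labels E) = 1 := by
  have h := matrixX_smul (src := src) (tgt := tgt) (z := 0) 0
  rw [smul_zero, zero_pow two_ne_zero, zero_smul] at h
  rw [detX, h, add_zero, Matrix.det_one]

theorem isConnected_detX_ne_zero [Fintype V] [DecidableEq V] (src tgt : E → V) :
    IsConnected {z : Labels E | detX src tgt z ≠ 0} := by
  refine IsPathConnected.isConnected ⟨0, by simp [detX_zero], fun {z} hz => ?_⟩
  -- Along the line `t ↦ t • z` the determinant is a polynomial in `t` with value `1` at `0`.
  -- Removing its finitely many roots leaves a path-connected set that contains both `0` and `1`.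
  let q : Polynomial ℂ :=
    (1 + (Polynomial.X ^ 2 : Polynomial ℂ) • (matrixX src tgt z).map Polynomial.C).det
  have hq : ∀ t, q.eval t = detX src tgt (t • z) := fun t => by
    rw [← Polynomial.coe_evalRingHom, RingHom.map_det, detX, matrixX_smul]
    congr 1
    ext i j
    simp [Matrix.one_apply, apply_ite]
    exact mul_comm _ _
  have hq0 : q ≠ 0 := fun h => by
    have := hq 0
    rw [h, zero_smul, detX_zero, Polynomial.eval_zero] at this
    exact zero_ne_one this
  have hfin : {t : ℂ | q.eval t = 0}.Finite := Polynomial.finite_setOfPred_isRoot hq0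
  have hpc : IsPathConnected {t : ℂ | q.eval t = 0}ᶜ :=
    hfin.countable.isPathConnected_compl_of_one_lt_rank (by simp [Complex.rank_real_complex])
  have himg := hpc.image (f := fun t : ℂ => t • z) (by fun_prop)
  have hj := himg.joinedIn 0 ⟨0, by simp [hq, detX_zero], zero_smul _ _⟩ z
    ⟨1, by simpa [hq] using hz, one_smul _ _⟩
  refine hj.mono ?_
  rintro _ ⟨t, ht, rfl⟩
  simpa [hq] using ht

end Graph

end SpinNetwork

end

/-! ### Evaluation and maximal analytic continuation. -/

theorem mainTheorem3 {V E : Type*} [Fintype V] [DecidableEq V] [Fintype E] (src tgt : E → V) :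
    -- for spinors of sufficiently small norm everything converges and all three quantities agree
    (∀ᶠ z : SpinNetwork.Labels E in 𝓝 0,
      SpinNetwork.HermPartPosDef src tgt z ∧
      Summable (SpinNetwork.genTerm src tgt z) ∧
      SpinNetwork.genFunctional src tgt z = SpinNetwork.gaussianIntegral src tgt z ∧
      SpinNetwork.gaussianIntegral src tgt z = 1 / SpinNetwork.detX src tgt z) ∧
    -- the Gaussian evaluation holds as soon as the hermitian part of `1 + X` is positive definite
    (∀ z : SpinNetwork.Labels E, SpinNetwork.HermPartPosDef src tgt z →
      Integrable (SpinNetwork.gaussianIntegrand src tgt z)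
        (Measure.pi fun _ => SpinNetwork.gaussianMeasure) ∧
      SpinNetwork.detX src tgt z ≠ 0 ∧
      SpinNetwork.gaussianIntegral src tgt z = 1 / SpinNetwork.detX src tgt z) ∧
    -- the evaluation of the generating functional holds wherever its series converges
    (∀ z : SpinNetwork.Labels E, Summable (SpinNetwork.genTerm src tgt z) →
      SpinNetwork.detX src tgt z ≠ 0 ∧
      SpinNetwork.genFunctional src tgt z = 1 / SpinNetwork.detX src tgt z) ∧
    -- `1 / det (1 + X)` is the analytic continuation of the generating functional, and its domain,
    -- the complement of the poles, is the maximal one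
    (IsOpen {z : SpinNetwork.Labels E | SpinNetwork.detX src tgt z ≠ 0} ∧
      IsConnected {z : SpinNetwork.Labels E | SpinNetwork.detX src tgt z ≠ 0} ∧
      AnalyticOnNhd ℂ (fun z : SpinNetwork.Labels E => 1 / SpinNetwork.detX src tgt z)
        {z : SpinNetwork.Labels E | SpinNetwork.detX src tgt z ≠ 0} ∧
      ∀ (U : Set (SpinNetwork.Labels E)) (F : SpinNetwork.Labels E → ℂ),
        IsOpen U → IsConnected U → 0 ∈ U → AnalyticOnNhd ℂ F U →
        F =ᶠ[𝓝 0] SpinNetwork.genFunctional src tgt →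
        ∀ z ∈ U, SpinNetwork.detX src tgt z ≠ 0 ∧ F z = 1 / SpinNetwork.detX src tgt z) := by
  have hgauss := SpinNetwork.gaussianIntegral_of_hermPartPosDef src tgt
  have hsmall := SpinNetwork.eventually_exponentBound src tgt
  have hcont : Continuous (SpinNetwork.detX src tgt) :=
    (SpinNetwork.analyticOnNhd_detX src tgt Set.univ).continuous
  refine ⟨?_, hgauss, fun z hz => ?_, isOpen_ne_fun hcont continuous_const,
    SpinNetwork.isConnected_detX_ne_zero src tgt, ?_, ?_⟩
  · filter_upwards [hsmall] with z hz
    exact ⟨hz.hermPartPosDef, hz.hasSum_genTerm.summable, hz.hasSum_genTerm.tsum_eq,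
      (hgauss z hz.hermPartPosDef).2.2⟩
  · have h := SpinNetwork.detX_mul_genFunctional_of_summable hz
    exact ⟨right_ne_zero_of_mul_eq_one h, eq_one_div_of_mul_eq_one_left h⟩
  · exact analyticOnNhd_const.div (SpinNetwork.analyticOnNhd_detX src tgt _) fun z hz => hz
  · intro U F hU hUc h0 hF hFg z hz
    -- The product, unlike the quotient, is analytic on all of `U`, so `U ⊆ D` need not be known
    -- beforehand and comes out as a consequence.
    have hloc : ∀ᶠ w in 𝓝 (0 : SpinNetwork.Labels E), F w * SpinNetwork.detX src tgt w = 1 := by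
      filter_upwards [hsmall, hFg] with w hw hFw
      rw [hFw]
      exact SpinNetwork.detX_mul_genFunctional_of_summable hw.hasSum_genTerm.summable
    have h : F z * SpinNetwork.detX src tgt z = 1 :=
      (hF.mul (SpinNetwork.analyticOnNhd_detX src tgt U)).eqOn_of_preconnected_of_eventuallyEq
        analyticOnNhd_const hUc.isPreconnected h0 hloc hz
    exact ⟨right_ne_zero_of_mul_eq_one h, eq_one_div_of_mul_eq_one_left h⟩
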